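/- For $n\ge 2$ let $A_n=(a_0,a_1,\dots,a_{n-1})$ be chosen uniformly at random from $\{-1,+1\}^n$. For a sequence $A=(a_0,\dots,a_{n-1})\in\{-1,+1\}^n$ and $0<u<n$ put $C_u(A)=\sum_{j=0}^{n-u-1}a_ja_{j+u}$, and define the peak sidelobe level $M(A)=\max_{0<u<n}|C_u(A)|$. Then, as $n\to\infty$, \[ \frac{M(A_n)}{\sqrt{n\log n}}\to\sqrt2\quad\text{in probability} \qquad\text{and}\qquad \frac{\mathbb{E}[M(A_n)]}{\sqrt{n\log n}}\to\sqrt2 , \] where convergence in probability means that $\Pr\big[\,|M(A_n)/\sqrt{n\log n}-\sqrt2|\ge\varepsilon\,\big]\to0$ for every $\varepsilon>0$, and $\log$ is the natural logarithm. -/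

import Mathlib

open MeasureTheory ProbabilityTheory Filter Topology

/-- The set `{-1, +1}^n` of binary sequences `(a_0, …, a_{n-1})` of length `n`. -/
def binarySequences (n : ℕ) : Set (Fin n → ℤ) :=
  {a | ∀ i, a i = -1 ∨ a i = 1}

/-- The aperiodic autocorrelation at shift `u` of a sequence `a` of length `n`:
`C_u(a) = ∑_{j=0}^{n-u-1} a_j a_{j+u}`. -/
def aperiodicAutocorrelation {n : ℕ} (u : ℕ) (a : Fin n → ℤ) : ℤ :=
  ∑ j : Fin (n - u), a ⟨j, by omega⟩ * a ⟨j + u, by omega⟩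

/-- The peak sidelobe level `M(a) = max_{0 < u < n} |C_u(a)|` of a sequence `a` of length `n > 1`.
(For `n ≤ 1` there is no nonzero shift, and the value is `0`.) -/
def peakSidelobeLevel {n : ℕ} (a : Fin n → ℤ) : ℕ :=
  (Finset.Ioo 0 n).sup fun u => (aperiodicAutocorrelation u a).natAbs

/-! Write L = √(n log n). Since C_u has the law of a sum of n - u independent signs, its exponential
moments are cosh(t)^(n-u), and the maximum is at most a sum of 2(n - 1) exponentials. Jensen then
gives E[M] ≤ (√2 + o(1)) L (`cubeMean_signPeak_le`).

For the lower bound, count the shifts u ≤ δ²n/2 with C_u close to √2 L or larger. Tilting bounds one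
tail from below (`le_cubeProb_signCorr`). A joint exponential moment bounds pairs from above
(`cubeMean_exp_signCorr_add_le`). The second moment method (`min_le_cubeProb_signPeak`) yields only
that M nearly reaches √2 L with probability at least n^(-10δ).

This weak bound suffices because M concentrates: changing one sign moves M by at most 4, so
McDiarmid bounds deviations εL from the mean by n^(-ε²/8). With δ much smaller than ε², a mean well
below √2 L would contradict the lower bound. Hence E[M]/L → √2 (`tendsto_cubeMean_signPeak`), and
concentration gives convergence in probability. -/

/-! ### Averages over the sign cube -/

/-- The mean of `f` over the uniformly distributed sign vector. -/
noncomputable def cubeMean {n : ℕ} (f : (Fin n → ℤˣ) → ℝ) : ℝ :=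
  (∑ x, f x) / 2 ^ n

theorem cubeMean_zero (f : (Fin 0 → ℤˣ) → ℝ) (x : Fin 0 → ℤˣ) : cubeMean f = f x := by
  simp [cubeMean]
  congr 1
  exact Subsingleton.elim _ _

theorem cubeMean_succ {n : ℕ} (f : (Fin (n + 1) → ℤˣ) → ℝ) :
    cubeMean f = (cubeMean (fun x => f (Fin.cons 1 x)) +
      cubeMean (fun x => f (Fin.cons (-1) x))) / 2 := by
  have h : ∑ x, f x = ∑ p : ℤˣ × (Fin n → ℤˣ), f (Fin.cons p.1 p.2) :=
    (Fintype.sum_equiv (Fin.consEquiv fun _ => ℤˣ) _ _ fun p => rfl).symm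
  have h2 : (Finset.univ : Finset ℤˣ) = {1, -1} := by decide
  rw [cubeMean, h, Fintype.sum_prod_type, h2,
    Finset.sum_insert (by decide), Finset.sum_singleton]
  simp only [cubeMean, pow_succ]
  field_simp

theorem cubeMean_mono {n : ℕ} {f g : (Fin n → ℤˣ) → ℝ} (h : ∀ x, f x ≤ g x) :
    cubeMean f ≤ cubeMean g := by
  unfold cubeMean
  gcongr
  exact h _

theorem cubeMean_add {n : ℕ} (f g : (Fin n → ℤˣ) → ℝ) :
    cubeMean (fun x => f x + g x) = cubeMean f + cubeMean g := by
  simp [cubeMean, Finset.sum_add_distrib, add_div]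

theorem cubeMean_const_mul {n : ℕ} (c : ℝ) (f : (Fin n → ℤˣ) → ℝ) :
    cubeMean (fun x => c * f x) = c * cubeMean f := by
  simp [cubeMean, ← Finset.mul_sum, mul_div_assoc]

theorem cubeMean_const {n : ℕ} (c : ℝ) : cubeMean (fun _ : Fin n → ℤˣ => c) = c := by
  simp [cubeMean, Fintype.card_pi]

theorem cubeMean_sum {n : ℕ} {ι : Type*} (s : Finset ι) (f : ι → (Fin n → ℤˣ) → ℝ) :
    cubeMean (fun x => ∑ i ∈ s, f i x) = ∑ i ∈ s, cubeMean (f i) := by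
  simp [cubeMean, Finset.sum_comm (s := Finset.univ), Finset.sum_div]

theorem cubeMean_nonneg {n : ℕ} {f : (Fin n → ℤˣ) → ℝ} (h : ∀ x, 0 ≤ f x) : 0 ≤ cubeMean f := by
  have := cubeMean_mono (f := fun _ => 0) h
  rwa [cubeMean_const] at this

theorem cubeMean_mul_sq_le {n : ℕ} (f g : (Fin n → ℤˣ) → ℝ) :
    cubeMean (fun x => f x * g x) ^ 2 ≤
      cubeMean (fun x => f x ^ 2) * cubeMean (fun x => g x ^ 2) := by
  have h := Finset.sum_mul_sq_le_sq_mul_sq Finset.univ f g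
  simp only [cubeMean, div_pow, div_mul_div_comm, ← sq]
  gcongr

/-- Jensen's inequality: average the tangent line of `exp` at the mean. -/
theorem exp_cubeMean_le {n : ℕ} (f : (Fin n → ℤˣ) → ℝ) :
    Real.exp (cubeMean f) ≤ cubeMean (fun x => Real.exp (f x)) := by
  have h : cubeMean (fun x => Real.exp (cubeMean f) * (1 - cubeMean f + f x)) ≤
      cubeMean (fun x => Real.exp (f x)) := by
    refine cubeMean_mono fun x => ?_
    have h1 := Real.add_one_le_exp (f x - cubeMean f)
    calc _ ≤ Real.exp (cubeMean f) * Real.exp (f x - cubeMean f) := by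
          gcongr; linarith
      _ = _ := by rw [← Real.exp_add]; ring_nf
  rw [cubeMean_const_mul, cubeMean_add, cubeMean_const] at h
  simpa using h

/-! ### Concentration for functions with bounded differences -/

/-- Two-point case of Hoeffding's lemma. -/
theorem exp_add_exp_half_le (a b : ℝ) :
    (Real.exp a + Real.exp b) / 2 ≤ Real.exp ((a + b) / 2 + (a - b) ^ 2 / 8) := by
  have h : (Real.exp a + Real.exp b) / 2 = Real.exp ((a + b) / 2) * Real.cosh ((a - b) / 2) := by
    rw [Real.cosh_eq, mul_div_assoc', mul_add, ← Real.exp_add, ← Real.exp_add]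
    ring_nf
  rw [h, Real.exp_add]
  gcongr
  refine (Real.cosh_le_exp_half_sq _).trans (le_of_eq ?_)
  ring_nf

/-- McDiarmid's inequality on the cube, in exponential form. -/
theorem cubeMean_exp_le_of_bounded_differences {n : ℕ} {f : (Fin n → ℤˣ) → ℝ} {c : ℝ}
    (hf : ∀ i x y, (∀ j, j ≠ i → x j = y j) → |f x - f y| ≤ c) (s : ℝ) :
    cubeMean (fun x => Real.exp (s * f x)) ≤
      Real.exp (s * cubeMean f + n * (s ^ 2 * c ^ 2 / 8)) := by
  induction n with
  | zero =>
    rw [cubeMean_zero _ default, cubeMean_zero _ default]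
    simp
  | succ n ih =>
    have key : ∀ e : ℤˣ, cubeMean (fun x => Real.exp (s * f (Fin.cons e x))) ≤
        Real.exp (s * cubeMean (fun x => f (Fin.cons e x)) + n * (s ^ 2 * c ^ 2 / 8)) := by
      intro e
      refine ih fun i x y hxy => hf i.succ _ _ fun j hj => ?_
      obtain rfl | ⟨k, rfl⟩ := j.eq_zero_or_eq_succ
      · simp
      · simpa using hxy k fun h => hj (by rw [h])
    rw [cubeMean_succ, cubeMean_succ f]
    set p := cubeMean (fun x => f (Fin.cons 1 x)) with hp
    set q := cubeMean (fun x => f (Fin.cons (-1) x)) with hq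
    -- The means conditioned on the first sign inherit the bounded difference, so the two-point
    -- bound costs s²c²/8 for this coordinate.
    have hpq : |p - q| ≤ c := by
      have h1 : ∀ x : Fin n → ℤˣ, |f (Fin.cons 1 x) - f (Fin.cons (-1) x)| ≤ c := by
        intro x
        refine hf 0 _ _ fun j hj => ?_
        obtain ⟨k, rfl⟩ := Fin.exists_succ_eq.mpr hj
        simp
      rw [abs_le]
      constructor
      · have : q ≤ cubeMean (fun x => c + f (Fin.cons 1 x)) :=
          cubeMean_mono fun x => by linarith [(abs_le.mp (h1 x)).1]
        rw [cubeMean_add, cubeMean_const] at this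
        linarith
      · have : p ≤ cubeMean (fun x => c + f (Fin.cons (-1) x)) :=
          cubeMean_mono fun x => by linarith [(abs_le.mp (h1 x)).2]
        rw [cubeMean_add, cubeMean_const] at this
        linarith
    calc _ ≤ (Real.exp (s * p + n * (s ^ 2 * c ^ 2 / 8)) +
          Real.exp (s * q + n * (s ^ 2 * c ^ 2 / 8))) / 2 := by
          have h1 := key 1
          have h2 := key (-1)
          linarith
      _ ≤ _ := by
        refine (exp_add_exp_half_le _ _).trans (Real.exp_le_exp.mpr ?_)
        have h3 : (p - q) ^ 2 ≤ c ^ 2 := sq_le_sq' (by linarith [(abs_le.mp hpq).1])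
          (by linarith [(abs_le.mp hpq).2])
        have h4 : s ^ 2 * (p - q) ^ 2 ≤ s ^ 2 * c ^ 2 := by gcongr
        push_cast
        nlinarith

/-! ### Exponential moments of quadratic forms in signs -/

theorem coe_unit_sq (e : ℤˣ) : ((e : ℤ) : ℝ) ^ 2 = 1 := by
  rcases Int.units_eq_one_or e with rfl | rfl <;> simp

/-- Bound for the exponential moment of a quadratic form with nonnegative coefficients in
independent signs, by successively averaging over the variables. -/
theorem cubeMean_exp_quadratic_le {n : ℕ} {D : ℝ} (hD1 : D ≤ 1) (B : Fin n → Fin n → ℝ)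
    (hsymm : ∀ i j, B i j = B j i) (hnonneg : ∀ i j, 0 ≤ B i j) (hrow : ∀ i, ∑ j, B i j ≤ D) :
    cubeMean (fun x => Real.exp ((∑ i, ∑ j, B i j * ((x i : ℤ) : ℝ) * ((x j : ℤ) : ℝ)) / 2)) ≤
      Real.exp ((∑ i, B i i) / 2 + (∑ i, ∑ j, B i j ^ 2) / 4 + n * D ^ 3) := by
  induction n with
  | zero => rw [cubeMean_zero _ default]; simp
  | succ n ih =>
    set b : Fin n → ℝ := fun k => B 0 k.succ with hb
    set B₁ : Fin n → Fin n → ℝ := fun k l => B k.succ l.succ with hB₁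
    have hb0 : ∀ k, 0 ≤ b k := fun k => hnonneg _ _
    have hB0 : ∀ k l, 0 ≤ B₁ k l := fun k l => hnonneg _ _
    have hbsum : ∑ k, b k ≤ D := by
      have := hrow 0
      rw [Fin.sum_univ_succ] at this
      linarith [hnonneg 0 0]
    have hD0 : 0 ≤ D := (Finset.sum_nonneg fun k _ => hb0 k).trans hbsum
    have hbD : ∀ k, b k ≤ D := fun k =>
      (Finset.single_le_sum (fun i _ => hb0 i) (Finset.mem_univ k)).trans hbsum
    have hB1row : ∀ k, b k + ∑ l, B₁ k l ≤ D := by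
      intro k
      have := hrow k.succ
      rw [Fin.sum_univ_succ, hsymm] at this
      exact this
    -- Averaging out the first sign gives cosh(b·x) ≤ exp((b·x)²/2), which adds the rank-one matrix
    -- b bᵀ to the remaining form. Row sums stay at most `D`: the new part of row k is b_k ∑ b ≤
    -- b_k, by `D ≤ 1`, and b_k was already counted in the old row.
    have ih' := ih (fun k l => B₁ k l + b k * b l)
      (fun k l => by simp only [hB₁]; rw [hsymm, mul_comm])
      (fun k l => add_nonneg (hB0 k l) (mul_nonneg (hb0 k) (hb0 l)))
      (fun k => by
        rw [Finset.sum_add_distrib, ← Finset.mul_sum]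
        have := hB1row k
        have h2 : b k * ∑ l, b l ≤ b k * 1 :=
          mul_le_mul_of_nonneg_left (hbsum.trans hD1) (hb0 k)
        linarith)
    have hsplit : ∀ (e : ℤˣ) (x : Fin n → ℤˣ),
        (∑ i, ∑ j, B i j * (((Fin.cons e x : Fin (n + 1) → ℤˣ) i : ℤ) : ℝ) *
          (((Fin.cons e x : Fin (n + 1) → ℤˣ) j : ℤ) : ℝ)) / 2 =
        B 0 0 / 2 + (∑ k, ∑ l, B₁ k l * ((x k : ℤ) : ℝ) * ((x l : ℤ) : ℝ)) / 2 +
          ((e : ℤ) : ℝ) * ∑ k, b k * ((x k : ℤ) : ℝ) := by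
      intro e x
      simp only [Fin.sum_univ_succ, Fin.cons_zero, Fin.cons_succ, Finset.sum_add_distrib]
      have h1 : ∑ k : Fin n, B k.succ 0 * ((x k : ℤ) : ℝ) * ((e : ℤ) : ℝ) =
          ((e : ℤ) : ℝ) * ∑ k, b k * ((x k : ℤ) : ℝ) := by
        rw [Finset.mul_sum]
        refine Finset.sum_congr rfl fun k _ => ?_
        rw [hsymm]; ring
      have h2 : ∑ k : Fin n, B 0 k.succ * ((e : ℤ) : ℝ) * ((x k : ℤ) : ℝ) =
          ((e : ℤ) : ℝ) * ∑ k, b k * ((x k : ℤ) : ℝ) := by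
        rw [Finset.mul_sum]
        refine Finset.sum_congr rfl fun k _ => ?_
        ring
      rw [h1, h2, mul_assoc (B 0 0), ← sq, coe_unit_sq]
      ring
    have hsq : ∀ x : Fin n → ℤˣ, (∑ k, b k * ((x k : ℤ) : ℝ)) ^ 2 =
        ∑ k, ∑ l, b k * b l * ((x k : ℤ) : ℝ) * ((x l : ℤ) : ℝ) := by
      intro x
      rw [sq, Finset.sum_mul_sum]
      refine Finset.sum_congr rfl fun k _ => Finset.sum_congr rfl fun l _ => ?_
      ring
    have hmean : cubeMean (fun x => Real.exp
          ((∑ i, ∑ j, B i j * ((x i : ℤ) : ℝ) * ((x j : ℤ) : ℝ)) / 2)) ≤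
        cubeMean (fun x => Real.exp (B 0 0 / 2) * Real.exp
          ((∑ k, ∑ l, (B₁ k l + b k * b l) * ((x k : ℤ) : ℝ) * ((x l : ℤ) : ℝ)) / 2)) := by
      rw [cubeMean_succ, ← cubeMean_add, div_eq_inv_mul, ← cubeMean_const_mul]
      refine cubeMean_mono fun x => ?_
      rw [hsplit, hsplit, ← div_eq_inv_mul, ← Real.exp_add]
      refine (exp_add_exp_half_le _ _).trans (Real.exp_le_exp.mpr (le_of_eq ?_))
      simp only [add_mul, Finset.sum_add_distrib, ← hsq]
      push_cast
      ring
    refine hmean.trans ?_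
    rw [cubeMean_const_mul]
    refine (mul_le_mul_of_nonneg_left ih' (Real.exp_nonneg _)).trans ?_
    rw [← Real.exp_add, Real.exp_le_exp]
    have hbsq : ∑ k, b k ^ 2 ≤ D ^ 2 := by
      calc ∑ k, b k ^ 2 ≤ ∑ k, D * b k := by
            refine Finset.sum_le_sum fun k _ => ?_
            rw [sq]; exact mul_le_mul_of_nonneg_right (hbD k) (hb0 k)
        _ ≤ D ^ 2 := by
            rw [← Finset.mul_sum, sq]; exact mul_le_mul_of_nonneg_left hbsum hD0
    -- The terms b_k² match on both sides. The excess is half this cross term plus a quarter of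
    -- `hquart`, at most 3D³/4, so D³ per variable is enough.
    have hcross : ∑ k, ∑ l, B₁ k l * (b k * b l) ≤ D ^ 3 := by
      calc ∑ k, ∑ l, B₁ k l * (b k * b l) ≤ ∑ k, b k * D * D := by
            refine Finset.sum_le_sum fun k _ => ?_
            calc ∑ l, B₁ k l * (b k * b l) ≤ ∑ l, b k * D * B₁ k l := by
                  refine Finset.sum_le_sum fun l _ => ?_
                  nlinarith [mul_le_mul_of_nonneg_left (hbD l) (mul_nonneg (hB0 k l) (hb0 k))]
              _ ≤ b k * D * D := by
                  rw [← Finset.mul_sum]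
                  refine mul_le_mul_of_nonneg_left ?_ (mul_nonneg (hb0 k) hD0)
                  linarith [hB1row k, hb0 k]
        _ ≤ D ^ 3 := by
            rw [← Finset.sum_mul, ← Finset.sum_mul]
            nlinarith [mul_le_mul_of_nonneg_right hbsum (mul_nonneg hD0 hD0)]
    have hquart : ∑ k, ∑ l, (b k * b l) ^ 2 ≤ D ^ 3 := by
      calc ∑ k, ∑ l, (b k * b l) ^ 2 = (∑ k, b k ^ 2) * ∑ l, b l ^ 2 := by
            rw [Finset.sum_mul_sum]; simp only [mul_pow]
        _ ≤ D ^ 2 * D ^ 2 := by gcongr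
        _ = D ^ 3 * D := by ring
        _ ≤ D ^ 3 * 1 := by gcongr
        _ = D ^ 3 := mul_one _
    have hexp : ∑ k, ∑ l, (B₁ k l + b k * b l) ^ 2 = ∑ k, ∑ l, B₁ k l ^ 2 +
        2 * ∑ k, ∑ l, B₁ k l * (b k * b l) + ∑ k, ∑ l, (b k * b l) ^ 2 := by
      simp only [Finset.mul_sum, ← Finset.sum_add_distrib]
      refine Finset.sum_congr rfl fun k _ => Finset.sum_congr rfl fun l _ => ?_
      ring
    have htr : ∑ k, (B₁ k k + b k * b k) = ∑ k, B₁ k k + ∑ k, b k ^ 2 := by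
      simp only [Finset.sum_add_distrib, sq]
    have hfull : ∑ i, ∑ j, B i j ^ 2 = B 0 0 ^ 2 + 2 * ∑ k, b k ^ 2 + ∑ k, ∑ l, B₁ k l ^ 2 := by
      simp only [Fin.sum_univ_succ, Finset.sum_add_distrib]
      have : ∑ k : Fin n, B k.succ 0 ^ 2 = ∑ k, b k ^ 2 :=
        Finset.sum_congr rfl fun k _ => by rw [hsymm]
      rw [this]
      simp only [hb, hB₁]
      ring
    rw [hexp, htr, hfull, Fin.sum_univ_succ]
    push_cast
    have : 0 ≤ D ^ 3 := pow_nonneg hD0 3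
    nlinarith [sq_nonneg (B 0 0)]

/-! ### Autocorrelations of sign vectors and their exponential moments -/

/-- The integer sequence underlying a sign vector. -/
def signSeq {n : ℕ} (x : Fin n → ℤˣ) : Fin n → ℤ := fun i => x i

/-- The aperiodic autocorrelation of a sign vector, as a real number. -/
noncomputable def signCorr {n : ℕ} (u : ℕ) (x : Fin n → ℤˣ) : ℝ :=
  (aperiodicAutocorrelation u (signSeq x) : ℤ)

/-- The peak sidelobe level of a sign vector, as a real number. -/
noncomputable def signPeak {n : ℕ} (x : Fin n → ℤˣ) : ℝ :=
  (peakSidelobeLevel (signSeq x) : ℕ)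

theorem signCorr_eq_sum {n : ℕ} (u : ℕ) (x : Fin n → ℤˣ) :
    signCorr u x =
      ∑ i : Fin n, ∑ j : Fin n, if (j : ℕ) = i + u then ((x i : ℤ) : ℝ) * ((x j : ℤ) : ℝ) else 0 := by
  let g : ℕ → ℝ := fun k =>
    if h : k + u < n then ((x ⟨k, by omega⟩ : ℤ) : ℝ) * ((x ⟨k + u, h⟩ : ℤ) : ℝ) else 0
  have h1 : signCorr u x = ∑ k ∈ Finset.range (n - u), g k := by
    rw [Finset.sum_range, signCorr, aperiodicAutocorrelation]
    push_cast
    refine Finset.sum_congr rfl fun j _ => ?_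
    have : (j : ℕ) + u < n := by omega
    simp [g, this, signSeq]
  have h2 : ∑ k ∈ Finset.range (n - u), g k = ∑ k ∈ Finset.range n, g k := by
    refine Finset.sum_subset (Finset.range_mono (by omega)) fun k _ hk => ?_
    rw [Finset.mem_range] at hk
    have : ¬ k + u < n := by omega
    simp [g, this]
  rw [h1, h2, Finset.sum_range]
  refine Finset.sum_congr rfl fun i _ => ?_
  by_cases h : (i : ℕ) + u < n
  · rw [Finset.sum_eq_single ⟨i + u, h⟩]
    · simp [g, h]
    · intro j _ hj
      rw [if_neg fun h' => hj (Fin.ext h')]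
    · simp
  · rw [Finset.sum_eq_zero]
    · simp [g, h]
    · intro j _
      rw [if_neg (by omega)]

theorem signCorr_cons {n u : ℕ} (hu : 0 < u) (e : ℤˣ) (x : Fin n → ℤˣ) :
    signCorr u (Fin.cons e x : Fin (n + 1) → ℤˣ) =
      (∑ j : Fin n, if (j : ℕ) + 1 = u then ((e : ℤ) : ℝ) * ((x j : ℤ) : ℝ) else 0) +
        signCorr u x := by
  simp only [signCorr_eq_sum, Fin.sum_univ_succ, Fin.cons_zero, Fin.cons_succ, Fin.val_zero,
    Fin.val_succ]
  have h1 : ∀ i : Fin n, ¬ (0 = (i : ℕ) + 1 + u) := fun i => by omega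
  have h2 : ∀ i j : Fin n, ((j : ℕ) + 1 = (i : ℕ) + 1 + u) ↔ (j : ℕ) = i + u :=
    fun i j => by omega
  simp [h1, h2, hu.ne]

/-- Prepending a sign e adds at most one product e·x_{u-1}. For fixed x its average over e
contributes cosh t, whatever the value of x_{u-1}. -/
theorem cubeMean_exp_signCorr {n u : ℕ} (hu : 0 < u) (t : ℝ) :
    cubeMean (fun x : Fin n → ℤˣ => Real.exp (t * signCorr u x)) = Real.cosh t ^ (n - u) := by
  induction n with
  | zero =>
    rw [cubeMean_zero _ default]
    simp [signCorr_eq_sum]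
  | succ n ih =>
    rw [cubeMean_succ]
    by_cases h : u ≤ n
    · have hs : ∀ (e : ℤˣ) (x : Fin n → ℤˣ),
          signCorr u (Fin.cons e x : Fin (n + 1) → ℤˣ) =
            ((e : ℤ) : ℝ) * ((x ⟨u - 1, by omega⟩ : ℤ) : ℝ) + signCorr u x := by
        intro e x
        rw [signCorr_cons hu, Finset.sum_eq_single ⟨u - 1, by omega⟩]
        · rw [if_pos (by simp; omega)]
        · intro j _ hj
          rw [if_neg fun h' => hj (Fin.ext (by simp; omega))]
        · simp
      rw [← cubeMean_add, div_eq_inv_mul, ← cubeMean_const_mul, Nat.succ_sub h, pow_succ, ← ih,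
        mul_comm (cubeMean _), ← cubeMean_const_mul]
      congr 1
      ext x
      rw [hs, hs, Real.cosh_eq]
      rcases Int.units_eq_one_or (x ⟨u - 1, by omega⟩) with hx | hx <;> rw [hx] <;>
        simp only [mul_add, Real.exp_add] <;> simp <;> ring
    · have hs : ∀ (e : ℤˣ) (x : Fin n → ℤˣ),
          signCorr u (Fin.cons e x : Fin (n + 1) → ℤˣ) = signCorr u x := by
        intro e x
        rw [signCorr_cons hu, Finset.sum_eq_zero, zero_add]
        intro j _
        rw [if_neg (by omega)]
      simp only [hs]
      rw [ih, show n - u = 0 by omega, show n + 1 - u = 0 by omega]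
      simp

theorem cubeMean_exp_signCorr_le {n u : ℕ} (hu : 0 < u) (t : ℝ) :
    cubeMean (fun x : Fin n → ℤˣ => Real.exp (t * signCorr u x)) ≤ Real.exp (n * t ^ 2 / 2) := by
  rw [cubeMean_exp_signCorr hu]
  calc Real.cosh t ^ (n - u) ≤ Real.cosh t ^ n :=
        pow_le_pow_right₀ (Real.one_le_cosh t) (Nat.sub_le _ _)
    _ ≤ Real.exp (t ^ 2 / 2) ^ n := by
        gcongr
        exact Real.cosh_le_exp_half_sq t
    _ = _ := by rw [← Real.exp_nat_mul]; ring_nf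

/-- With s = t²/2: cosh t ≥ 1 + s and log(1 + s) ≥ s/(1 + s) ≥ s - s². -/
theorem exp_sub_le_cosh (t : ℝ) : Real.exp (t ^ 2 / 2 - t ^ 4 / 4) ≤ Real.cosh t := by
  have h1 : 1 + t ^ 2 / 2 ≤ Real.cosh t := by
    have hs : (t / 2) ^ 2 ≤ Real.sinh (t / 2) ^ 2 := by
      rw [sq_le_sq, Real.abs_sinh]
      exact Real.self_le_sinh_iff.mpr (abs_nonneg _)
    have hc := Real.cosh_two_mul (t / 2)
    rw [mul_div_cancel₀ t two_ne_zero, Real.cosh_sq] at hc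
    nlinarith
  refine le_trans ?_ h1
  have hpos : 0 < 1 + t ^ 2 / 2 := by positivity
  rw [← Real.le_log_iff_exp_le hpos]
  refine le_trans ?_ (Real.one_sub_inv_le_log_of_pos hpos)
  rw [← sub_nonneg]
  have : 1 - (1 + t ^ 2 / 2)⁻¹ - (t ^ 2 / 2 - t ^ 4 / 4) = (t ^ 2 / 2) ^ 3 / (1 + t ^ 2 / 2) := by
    field_simp
    ring
  rw [this]
  positivity

theorem le_cubeMean_exp_signCorr {n u : ℕ} (hu : 0 < u) {κ t : ℝ} (hκ : u ≤ κ * n) (hun : u ≤ n) :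
    Real.exp ((1 - κ) * (n * t ^ 2) / 2 - n * t ^ 4 / 4) ≤
      cubeMean (fun x : Fin n → ℤˣ => Real.exp (t * signCorr u x)) := by
  rw [cubeMean_exp_signCorr hu]
  refine le_trans ?_ (pow_le_pow_left₀ (Real.exp_nonneg _) (exp_sub_le_cosh t) (n - u))
  rw [← Real.exp_nat_mul, Real.exp_le_exp, Nat.cast_sub hun]
  have h1 : (u : ℝ) * t ^ 2 ≤ κ * n * t ^ 2 := by gcongr
  have h2 : 0 ≤ (u : ℝ) * t ^ 4 := by positivity
  nlinarith

/-! ### Bounded differences and the upper bound for the mean peak -/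

/-- Each entry occurs in at most two products, and each product changes by at most 2. -/
theorem abs_signCorr_sub_le {n u : ℕ} (i : Fin n) (x y : Fin n → ℤˣ)
    (h : ∀ j, j ≠ i → x j = y j) : |signCorr u x - signCorr u y| ≤ 4 := by
  have habs : ∀ e : ℤˣ, |((e : ℤ) : ℝ)| = 1 := fun e => by
    rcases Int.units_eq_one_or e with rfl | rfl <;> simp
  rw [signCorr_eq_sum, signCorr_eq_sum]
  simp only [← Finset.sum_sub_distrib]
  calc _ ≤ ∑ k : Fin n, ∑ l : Fin n, ((if (k = i ∧ (l : ℕ) = k + u) then (2 : ℝ) else 0) +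
        (if (l = i ∧ (l : ℕ) = k + u) then (2 : ℝ) else 0)) := by
        refine (Finset.abs_sum_le_sum_abs _ _).trans (Finset.sum_le_sum fun k _ => ?_)
        refine (Finset.abs_sum_le_sum_abs _ _).trans (Finset.sum_le_sum fun l _ => ?_)
        by_cases hl : (l : ℕ) = k + u
        · have h2 : |((x k : ℤ) : ℝ) * ((x l : ℤ) : ℝ) - ((y k : ℤ) : ℝ) * ((y l : ℤ) : ℝ)| ≤ 2 := by
            refine (abs_sub _ _).trans ?_
            rw [abs_mul, abs_mul, habs, habs, habs, habs]
            norm_num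
          by_cases hk : k = i
          · simp only [if_pos hl, if_pos (And.intro hk hl)]
            split_ifs <;> linarith
          · by_cases hli : l = i
            · simp only [if_pos hl, if_pos (And.intro hli hl)]
              split_ifs <;> linarith
            · simp [hl, hk, hli, h k hk, h l hli]
        · simp [hl]
    _ = ∑ l : Fin n, (if (l : ℕ) = i + u then (2 : ℝ) else 0) +
        ∑ k : Fin n, (if (i : ℕ) = k + u then (2 : ℝ) else 0) := by
        simp only [Finset.sum_add_distrib]
        congr 1
        · rw [Finset.sum_eq_single i]
          · simp
          · intro k _ hk; simp [hk]
          · simp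
        · refine Finset.sum_congr rfl fun k _ => ?_
          rw [Finset.sum_eq_single i]
          · simp
          · intro k _ hk; simp [hk]
          · simp
    _ ≤ 2 + 2 := by
        have hle : ∀ p : Fin n → Prop, ∀ [DecidablePred p], (∀ a b, p a → p b → a = b) →
            ∑ k, (if p k then (2 : ℝ) else 0) ≤ 2 := by
          intro p _ hp
          by_cases hex : ∃ k, p k
          · obtain ⟨k, hk⟩ := hex
            rw [Finset.sum_eq_single k]
            · simp [hk]
            · intro l _ hl
              rw [if_neg fun h' => hl (hp _ _ h' hk)]
            · simp
          · push Not at hex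
            simp [hex]
        refine add_le_add (hle _ fun a b ha hb => Fin.ext (by omega))
          (hle _ fun a b ha hb => Fin.ext (by omega))
    _ = 4 := by norm_num

theorem abs_signCorr_le_signPeak {n u : ℕ} (hu : u ∈ Finset.Ioo 0 n) (x : Fin n → ℤˣ) :
    |signCorr u x| ≤ signPeak x := by
  have := Finset.le_sup (f := fun u => (aperiodicAutocorrelation u (signSeq x)).natAbs) hu
  rw [signCorr, signPeak, ← Int.cast_abs, Int.abs_eq_natAbs, peakSidelobeLevel]
  exact_mod_cast this

theorem exists_signPeak_eq {n : ℕ} (hn : 2 ≤ n) (x : Fin n → ℤˣ) :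
    ∃ u ∈ Finset.Ioo 0 n, signPeak x = |signCorr u x| := by
  obtain ⟨u, hu, h⟩ := Finset.exists_mem_eq_sup (Finset.Ioo 0 n)
    ⟨1, by simp; omega⟩ fun u => (aperiodicAutocorrelation u (signSeq x)).natAbs
  refine ⟨u, hu, ?_⟩
  rw [signCorr, signPeak, ← Int.cast_abs, Int.abs_eq_natAbs, peakSidelobeLevel, h]
  simp

theorem abs_signPeak_sub_le {n : ℕ} (hn : 2 ≤ n) (i : Fin n) (x y : Fin n → ℤˣ)
    (h : ∀ j, j ≠ i → x j = y j) : |signPeak x - signPeak y| ≤ 4 := by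
  have key : ∀ x y : Fin n → ℤˣ, (∀ j, j ≠ i → x j = y j) → signPeak x - signPeak y ≤ 4 := by
    intro x y h
    obtain ⟨u, hu, hx⟩ := exists_signPeak_eq hn x
    have h1 := abs_signCorr_le_signPeak hu y
    have h2 := abs_signCorr_sub_le (u := u) i x y h
    have h3 := abs_sub_abs_le_abs_sub (signCorr u x) (signCorr u y)
    linarith
  rw [abs_le]
  constructor
  · linarith [key y x fun j hj => (h j hj).symm]
  · exact key x y h

theorem cubeMean_exp_signPeak_le {n : ℕ} (hn : 2 ≤ n) (s : ℝ) :
    cubeMean (fun x : Fin n → ℤˣ => Real.exp (s * signPeak x)) ≤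
      Real.exp (s * cubeMean (n := n) signPeak + 2 * n * s ^ 2) := by
  refine (cubeMean_exp_le_of_bounded_differences
    (fun i x y h => abs_signPeak_sub_le hn i x y h) s).trans (le_of_eq ?_)
  ring_nf

/-- Jensen, with the maximum replaced by a sum over all shifts and both signs. The parameter `t` is
left free for later optimisation. -/
theorem cubeMean_signPeak_le {n : ℕ} (hn : 2 ≤ n) {t : ℝ} (ht : 0 < t) :
    cubeMean (n := n) signPeak ≤ Real.log (2 * n) / t + n * t / 2 := by
  have h1 := exp_cubeMean_le (fun x : Fin n → ℤˣ => t * signPeak x)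
  have h2 : cubeMean (fun x : Fin n → ℤˣ => Real.exp (t * signPeak x)) ≤
      cubeMean (fun x : Fin n → ℤˣ => ∑ u ∈ Finset.Ioo 0 n,
        (Real.exp (t * signCorr u x) + Real.exp (-t * signCorr u x))) := by
    refine cubeMean_mono fun x => ?_
    obtain ⟨u, hu, hx⟩ := exists_signPeak_eq hn x
    have h3 : Real.exp (t * signPeak x) ≤
        Real.exp (t * signCorr u x) + Real.exp (-t * signCorr u x) := by
      rw [hx]
      rcases abs_cases (signCorr u x) with ⟨h, _⟩ | ⟨h, _⟩ <;> rw [h]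
      · linarith [Real.exp_pos (-t * signCorr u x)]
      · rw [mul_neg, ← neg_mul]
        linarith [Real.exp_pos (t * signCorr u x)]
    exact h3.trans (Finset.single_le_sum (f := fun u => Real.exp (t * signCorr u x) +
      Real.exp (-t * signCorr u x)) (fun _ _ => by positivity) hu)
  rw [cubeMean_sum] at h2
  have h4 : ∑ u ∈ Finset.Ioo 0 n, cubeMean (fun x : Fin n → ℤˣ =>
      (Real.exp (t * signCorr u x) + Real.exp (-t * signCorr u x))) ≤
      ∑ u ∈ Finset.Ioo 0 n, 2 * Real.exp (n * t ^ 2 / 2) := by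
    refine Finset.sum_le_sum fun u hu => ?_
    rw [Finset.mem_Ioo] at hu
    rw [cubeMean_add]
    have a := cubeMean_exp_signCorr_le (n := n) hu.1 t
    have b := cubeMean_exp_signCorr_le (n := n) hu.1 (-t)
    rw [neg_sq] at b
    linarith
  have hn0 : (0 : ℝ) < 2 * n := by positivity
  have h5 : ∑ u ∈ Finset.Ioo 0 n, 2 * Real.exp (n * t ^ 2 / 2) ≤
      Real.exp (Real.log (2 * n) + n * t ^ 2 / 2) := by
    rw [Real.exp_add, Real.exp_log hn0, Finset.sum_const, nsmul_eq_mul, Nat.card_Ioo]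
    have : ((n - 0 - 1 : ℕ) : ℝ) ≤ n := by exact_mod_cast (by omega)
    have := mul_le_mul_of_nonneg_right this (Real.exp_nonneg (n * t ^ 2 / 2))
    linarith
  have h6 := Real.exp_le_exp.mp (h1.trans (h2.trans (h4.trans h5)))
  rw [cubeMean_const_mul] at h6
  have h7 : Real.log (2 * n) / t + n * t / 2 = (Real.log (2 * n) + n * t ^ 2 / 2) / t := by
    field_simp
  rw [h7, le_div_iff₀ ht]
  linarith

/-! ### Joint exponential moment at two shifts -/

/-- The exponent is half the form of the symmetric matrix with entry t where |i - j| is u or v. Rows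
have at most four such entries, so D = 4t and D³ = 64t³. The leading term n t² is what two
independent sums of n signs would give. -/
theorem cubeMean_exp_signCorr_add_le {n u v : ℕ} (hu : 0 < u) (hv : 0 < v) (huv : u ≠ v) {t : ℝ}
    (ht : 0 ≤ t) (ht4 : 4 * t ≤ 1) :
    cubeMean (fun x : Fin n → ℤˣ => Real.exp (t * (signCorr u x + signCorr v x))) ≤
      Real.exp (n * t ^ 2 + 64 * (n * t ^ 3)) := by
  let p : ℕ → Fin n → Fin n → ℝ := fun w i j => if (j : ℕ) = i + w then 1 else 0
  let B : Fin n → Fin n → ℝ := fun i j => t * (p u i j + p u j i + (p v i j + p v j i))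
  have hp0 : ∀ w i j, 0 ≤ p w i j := fun w i j => by simp only [p]; positivity
  have hform : ∀ w (x : Fin n → ℤˣ),
      signCorr w x = ∑ i, ∑ j, p w i j * ((x i : ℤ) : ℝ) * ((x j : ℤ) : ℝ) := by
    intro w x
    rw [signCorr_eq_sum]
    refine Finset.sum_congr rfl fun i _ => Finset.sum_congr rfl fun j _ => ?_
    simp only [p]
    split_ifs <;> simp
  have hform' : ∀ w (x : Fin n → ℤˣ),
      signCorr w x = ∑ i, ∑ j, p w j i * ((x i : ℤ) : ℝ) * ((x j : ℤ) : ℝ) := by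
    intro w x
    rw [hform, Finset.sum_comm]
    refine Finset.sum_congr rfl fun i _ => Finset.sum_congr rfl fun j _ => ?_
    ring
  have hB : ∀ x : Fin n → ℤˣ, t * (signCorr u x + signCorr v x) =
      (∑ i, ∑ j, B i j * ((x i : ℤ) : ℝ) * ((x j : ℤ) : ℝ)) / 2 := by
    intro x
    have : ∑ i, ∑ j, B i j * ((x i : ℤ) : ℝ) * ((x j : ℤ) : ℝ) =
        t * (signCorr u x + signCorr u x + (signCorr v x + signCorr v x)) := by
      nth_rewrite 1 [hform u x]
      nth_rewrite 1 [hform v x]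
      rw [hform' u x, hform' v x]
      simp only [← Finset.sum_add_distrib, Finset.mul_sum]
      refine Finset.sum_congr rfl fun i _ => Finset.sum_congr rfl fun j _ => ?_
      simp only [B]
      ring
    rw [this]; ring
  have hle : ∀ q : Fin n → Prop, ∀ [DecidablePred q], (∀ a b, q a → q b → a = b) →
      ∑ k, (if q k then (1 : ℝ) else 0) ≤ 1 := by
    intro q _ hq
    by_cases hex : ∃ k, q k
    · obtain ⟨k, hk⟩ := hex
      rw [Finset.sum_eq_single k]
      · simp [hk]
      · intro l _ hl
        rw [if_neg fun h' => hl (hq _ _ h' hk)]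
      · simp
    · push Not at hex
      simp [hex]
  have hrow1 : ∀ w i, ∑ j, p w i j ≤ 1 := fun w i =>
    hle _ fun a b ha hb => Fin.ext (by omega)
  have hrow2 : ∀ w i, ∑ j, p w j i ≤ 1 := fun w i =>
    hle _ fun a b ha hb => Fin.ext (by omega)
  have hrow : ∀ i, ∑ j, B i j ≤ 4 * t := by
    intro i
    simp only [B, ← Finset.mul_sum, Finset.sum_add_distrib]
    nlinarith [hrow1 u i, hrow1 v i, hrow2 u i, hrow2 v i]
  have hBnn : ∀ i j, 0 ≤ B i j := fun i j => mul_nonneg ht (by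
    linarith [hp0 u i j, hp0 u j i, hp0 v i j, hp0 v j i])
  -- Since u ≠ v and both are positive, at most one of the four indicators is nonzero at any (i, j).
  have hBt : ∀ i j, B i j ≤ t := by
    intro i j
    have : p u i j + p u j i + (p v i j + p v j i) ≤ 1 := by
      simp only [p]
      split_ifs <;> first | omega | norm_num
    simpa [B] using mul_le_mul_of_nonneg_left this ht
  have hdiag : ∀ i, B i i = 0 := fun i => by simp [B, p, hu.ne', hv.ne']
  have hsq : ∑ i, ∑ j, B i j ^ 2 ≤ n * (4 * t ^ 2) := by
    calc ∑ i, ∑ j, B i j ^ 2 ≤ ∑ i : Fin n, 4 * t ^ 2 := by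
          refine Finset.sum_le_sum fun i _ => ?_
          calc ∑ j, B i j ^ 2 ≤ ∑ j, t * B i j := by
                refine Finset.sum_le_sum fun j _ => ?_
                rw [sq]; exact mul_le_mul_of_nonneg_right (hBt i j) (hBnn i j)
            _ ≤ 4 * t ^ 2 := by
                rw [← Finset.mul_sum]
                nlinarith [hrow i]
      _ = _ := by simp
  simp only [hB]
  refine (cubeMean_exp_quadratic_le ht4 B (fun i j => by simp only [B]; ring) hBnn hrow).trans ?_
  rw [Real.exp_le_exp]
  simp only [hdiag, Finset.sum_const_zero]
  nlinarith

/-! ### Tail bounds -/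

/-- The probability that a uniformly distributed sign vector has the property `q`. -/
noncomputable def cubeProb {n : ℕ} (q : (Fin n → ℤˣ) → Prop) : ℝ :=
  open Classical in cubeMean fun x => if q x then 1 else 0

theorem cubeProb_mono {n : ℕ} {q r : (Fin n → ℤˣ) → Prop} (h : ∀ x, q x → r x) :
    cubeProb q ≤ cubeProb r := by
  refine cubeMean_mono fun x => ?_
  by_cases hq : q x
  · simp [hq, h x hq]
  · rw [if_neg hq]; positivity

theorem cubeProb_nonneg {n : ℕ} (q : (Fin n → ℤˣ) → Prop) : 0 ≤ cubeProb q :=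
  cubeMean_nonneg fun x => by positivity

theorem cubeProb_or_le {n : ℕ} (q r : (Fin n → ℤˣ) → Prop) :
    cubeProb (fun x => q x ∨ r x) ≤ cubeProb q + cubeProb r := by
  rw [cubeProb, cubeProb, cubeProb, ← cubeMean_add]
  refine cubeMean_mono fun x => ?_
  by_cases hq : q x <;> by_cases hr : r x <;> simp [hq, hr]

/-- Chernoff's bound on the cube. -/
theorem cubeProb_le_exp {n : ℕ} (f : (Fin n → ℤˣ) → ℝ) (b : ℝ) {K : ℝ}
    (hK : cubeMean (fun x => Real.exp (f x)) ≤ Real.exp K) :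
    cubeProb (fun x => b ≤ f x) ≤ Real.exp (K - b) := by
  have h : cubeProb (fun x => b ≤ f x) ≤
      cubeMean (fun x => Real.exp (-b) * Real.exp (f x)) := by
    refine cubeMean_mono fun x => ?_
    split_ifs with hx
    · rw [← Real.exp_add]; exact Real.one_le_exp (by linarith)
    · positivity
  rw [cubeMean_const_mul] at h
  refine h.trans ((mul_le_mul_of_nonneg_left hK (Real.exp_nonneg _)).trans (le_of_eq ?_))
  rw [← Real.exp_add]; ring_nf

/-- Chernoff with s = θ/(4n), the minimiser of 2ns² - sθ. -/
theorem cubeProb_signPeak_upper {n : ℕ} (hn : 2 ≤ n) {θ : ℝ} (hθ : 0 < θ) :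
    cubeProb (fun x : Fin n → ℤˣ => cubeMean (n := n) signPeak + θ ≤ signPeak x) ≤
      Real.exp (-(θ ^ 2 / (8 * n))) := by
  have hn0 : (0 : ℝ) < n := by positivity
  have h := cubeProb_le_exp (fun x : Fin n → ℤˣ => θ / (4 * n) * signPeak x)
    (θ / (4 * n) * (cubeMean (n := n) signPeak + θ)) (cubeMean_exp_signPeak_le hn _)
  refine (cubeProb_mono fun x hx => ?_).trans (h.trans (le_of_eq ?_))
  · gcongr
  · congr 1; field_simp; ring

theorem cubeProb_signPeak_lower {n : ℕ} (hn : 2 ≤ n) {θ : ℝ} (hθ : 0 < θ) :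
    cubeProb (fun x : Fin n → ℤˣ => signPeak x ≤ cubeMean (n := n) signPeak - θ) ≤
      Real.exp (-(θ ^ 2 / (8 * n))) := by
  have hn0 : (0 : ℝ) < n := by positivity
  have h := cubeProb_le_exp (fun x : Fin n → ℤˣ => -(θ / (4 * n)) * signPeak x)
    (-(θ / (4 * n)) * (cubeMean (n := n) signPeak - θ)) (cubeMean_exp_signPeak_le hn _)
  refine (cubeProb_mono fun x hx => ?_).trans (h.trans (le_of_eq ?_))
  · rw [neg_mul, neg_mul, neg_le_neg_iff]; gcongr
  · congr 1; field_simp; ring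

/-- Lower bound for the upper tail of one autocorrelation, by exponential tilting. -/
theorem le_cubeProb_signCorr {n u : ℕ} (hu : 0 < u) (hun : u ≤ n) {t δ : ℝ} (ht : 0 ≤ t)
    (hδ : 0 ≤ δ) (hκ : u ≤ δ ^ 2 / 2 * n) (ht4 : n * t ^ 4 ≤ 4)
    (hy : 12 ≤ n * t ^ 2 * δ ^ 2) :
    Real.exp (-(n * t ^ 2) * (1 / 2 + δ + δ ^ 2 / 4) - 1) / 2 ≤
      cubeProb (fun x : Fin n → ℤˣ => (1 - δ) * (n * t) ≤ signCorr u x) := by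
  set y : ℝ := n * t ^ 2 with hy_def
  -- Under the tilt by `t`, the autocorrelation sits near nt. Inside the window (1 ± δ)nt the
  -- exponential is at most e^((1+δ)y); below and above it, it is dominated by the exponentials with
  -- tilts (1 - δ)t and (1 + δ)t.
  have hpt : ∀ x : Fin n → ℤˣ, Real.exp (t * signCorr u x) ≤
      Real.exp ((1 + δ) * y) * (open Classical in
          if (1 - δ) * (n * t) ≤ signCorr u x then (1 : ℝ) else 0) +
        Real.exp (δ * (1 - δ) * y) * Real.exp ((1 - δ) * t * signCorr u x) +
        Real.exp (-(δ * (1 + δ) * y)) * Real.exp ((1 + δ) * t * signCorr u x) := by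
    intro x
    have hδt : 0 ≤ δ * t := mul_nonneg hδ ht
    rw [← Real.exp_add, ← Real.exp_add]
    by_cases h1 : (1 - δ) * (n * t) ≤ signCorr u x
    · rw [if_pos h1, mul_one]
      by_cases h2 : signCorr u x ≤ (1 + δ) * (n * t)
      · have : Real.exp (t * signCorr u x) ≤ Real.exp ((1 + δ) * y) := by
          rw [Real.exp_le_exp, hy_def]
          nlinarith [mul_le_mul_of_nonneg_left h2 ht]
        linarith [Real.exp_pos ((1 + δ) * y),
            Real.exp_pos (δ * (1 - δ) * y + (1 - δ) * t * signCorr u x),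
            Real.exp_pos (-(δ * (1 + δ) * y) + (1 + δ) * t * signCorr u x)]
      · have : Real.exp (t * signCorr u x) ≤
            Real.exp (-(δ * (1 + δ) * y) + (1 + δ) * t * signCorr u x) := by
          rw [Real.exp_le_exp, hy_def]
          push Not at h2
          nlinarith [mul_le_mul_of_nonneg_left h2.le hδt]
        linarith [Real.exp_pos ((1 + δ) * y),
            Real.exp_pos (δ * (1 - δ) * y + (1 - δ) * t * signCorr u x),
            Real.exp_pos (-(δ * (1 + δ) * y) + (1 + δ) * t * signCorr u x)]
    · rw [if_neg h1, mul_zero, zero_add]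
      have : Real.exp (t * signCorr u x) ≤
          Real.exp (δ * (1 - δ) * y + (1 - δ) * t * signCorr u x) := by
        rw [Real.exp_le_exp, hy_def]
        push Not at h1
        nlinarith [mul_le_mul_of_nonneg_left h1.le hδt]
      linarith [Real.exp_pos (-(δ * (1 + δ) * y) + (1 + δ) * t * signCorr u x)]
  have hmean := (le_cubeMean_exp_signCorr hu hκ hun (t := t)).trans (cubeMean_mono hpt)
  rw [cubeMean_add, cubeMean_add, cubeMean_const_mul, cubeMean_const_mul, cubeMean_const_mul]
    at hmean
  change _ ≤ _ * cubeProb (fun x : Fin n → ℤˣ => (1 - δ) * (n * t) ≤ signCorr u x) + _ + _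
    at hmean
  set π := cubeProb (fun x : Fin n → ℤˣ => (1 - δ) * (n * t) ≤ signCorr u x)
  have hlow : Real.exp (δ * (1 - δ) * y) *
      cubeMean (fun x : Fin n → ℤˣ => Real.exp ((1 - δ) * t * signCorr u x)) ≤
      Real.exp ((1 - δ ^ 2) * y / 2) := by
    refine (mul_le_mul_of_nonneg_left (cubeMean_exp_signCorr_le hu _)
      (Real.exp_nonneg _)).trans (le_of_eq ?_)
    rw [← Real.exp_add, hy_def]; ring_nf
  have hhigh : Real.exp (-(δ * (1 + δ) * y)) *
      cubeMean (fun x : Fin n → ℤˣ => Real.exp ((1 + δ) * t * signCorr u x)) ≤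
      Real.exp ((1 - δ ^ 2) * y / 2) := by
    refine (mul_le_mul_of_nonneg_left (cubeMean_exp_signCorr_le hu _)
      (Real.exp_nonneg _)).trans (le_of_eq ?_)
    rw [← Real.exp_add, hy_def]; ring_nf
  set m : ℝ := Real.exp ((1 - δ ^ 2 / 2) * y / 2 - 1) with hm
  have hmain : m ≤ Real.exp ((1 - δ ^ 2 / 2) * y / 2 - n * t ^ 4 / 4) := by
    rw [hm, Real.exp_le_exp]; linarith
  -- The main exponent exceeds those of the two tails by δ²y/4 before the loss of 1; `hy` makes this
  -- at least 3. So the tails take at most half of `m`.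
  have hsmall : 4 * Real.exp ((1 - δ ^ 2) * y / 2) ≤ m := by
    have h4 : (4 : ℝ) ≤ Real.exp 2 := by
      have := Real.quadratic_le_exp_of_nonneg (x := 2) (by norm_num)
      linarith
    refine (mul_le_mul_of_nonneg_right h4 (Real.exp_nonneg _)).trans ?_
    rw [← Real.exp_add, hm, Real.exp_le_exp]
    linarith
  have hfin : m / 2 ≤ Real.exp ((1 + δ) * y) * π := by linarith
  have : Real.exp (-((1 + δ) * y)) * (m / 2) ≤ π := by
    refine (mul_le_mul_of_nonneg_left hfin (Real.exp_nonneg _)).trans (le_of_eq ?_)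
    rw [← mul_assoc, ← Real.exp_add]; simp
  refine le_trans (le_of_eq ?_) this
  rw [hm, mul_div_assoc', ← Real.exp_add]
  ring_nf

/-! ### Second moment method -/

/-- Second moment bound for the probability that the peak sidelobe level is large. -/
theorem min_le_cubeProb_signPeak {n : ℕ} {U : Finset ℕ} (hU : U ⊆ Finset.Ioo 0 n)
    (hUne : U.Nonempty) {b p q : ℝ} (hp0 : 0 < p) (hq0 : 0 < q)
    (hp : ∀ u ∈ U, p ≤ cubeProb (fun x : Fin n → ℤˣ => b ≤ signCorr u x))
    (hq : ∀ u ∈ U, ∀ v ∈ U, u ≠ v →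
      cubeProb (fun x : Fin n → ℤˣ => b ≤ signCorr u x ∧ b ≤ signCorr v x) ≤ q) :
    min (U.card * p / 2) (p ^ 2 / (2 * q)) ≤
      cubeProb (fun x : Fin n → ℤˣ => b ≤ signPeak x) := by
  classical
  let I : ℕ → (Fin n → ℤˣ) → ℝ := fun u x => if b ≤ signCorr u x then 1 else 0
  let J : (Fin n → ℤˣ) → ℝ := fun x => if b ≤ signPeak x then 1 else 0
  have hI : ∀ u, cubeMean (I u) = cubeProb (fun x : Fin n → ℤˣ => b ≤ signCorr u x) := by
    intro u
    rw [cubeProb]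
  have hJ : cubeMean J = cubeProb (fun x : Fin n → ℤˣ => b ≤ signPeak x) := by
    rw [cubeProb]
  have hII : ∀ u v, cubeMean (fun x => I u x * I v x) =
      cubeProb (fun x : Fin n → ℤˣ => b ≤ signCorr u x ∧ b ≤ signCorr v x) := by
    intro u v
    rw [cubeProb]
    congr 1
    ext x
    by_cases h : b ≤ signCorr u x <;> by_cases h' : b ≤ signCorr v x <;> simp [I, h, h']
  set N : ℝ := ((U.card : ℕ) : ℝ) with hN
  have hN0 : 0 < N := by rw [hN]; exact_mod_cast hUne.card_pos
  set μ := cubeMean (fun x => ∑ u ∈ U, I u x) with hμ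
  have hμsum : μ = ∑ u ∈ U, cubeMean (I u) := cubeMean_sum _ _
  have hμp : N * p ≤ μ := by
    rw [hμsum, hN, ← nsmul_eq_mul]
    exact Finset.card_nsmul_le_sum _ _ _ fun u hu => (hp u hu).trans_eq (hI u).symm
  have hμ0 : 0 < μ := lt_of_lt_of_le (by positivity) hμp
  have hsecond : cubeMean (fun x => (∑ u ∈ U, I u x) ^ 2) ≤ μ + N ^ 2 * q := by
    have h1 : ∀ x : Fin n → ℤˣ, (∑ u ∈ U, I u x) ^ 2 = ∑ u ∈ U, ∑ v ∈ U, I u x * I v x := by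
      intro x; rw [sq, Finset.sum_mul_sum]
    simp only [h1, cubeMean_sum]
    calc ∑ u ∈ U, ∑ v ∈ U, cubeMean (fun x => I u x * I v x)
        ≤ ∑ u ∈ U, ∑ v ∈ U, ((if u = v then cubeMean (I u) else 0) + q) := by
          refine Finset.sum_le_sum fun u hu => Finset.sum_le_sum fun v hv => ?_
          by_cases huv : u = v
          · subst huv
            have : (fun x : Fin n → ℤˣ => I u x * I u x) = I u := by
              ext x; simp [I]
            rw [this]; simp [hq0.le]
          · rw [hII, if_neg huv, zero_add]
            exact hq u hu v hv huv
      _ = μ + N ^ 2 * q := by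
          simp only [Finset.sum_add_distrib, Finset.sum_ite_eq, Finset.sum_const, nsmul_eq_mul]
          rw [hμsum, Finset.sum_congr rfl fun u hu => if_pos hu]
          ring
  have hXJ : ∀ x, (∑ u ∈ U, I u x) * J x = ∑ u ∈ U, I u x := by
    intro x
    by_cases h : b ≤ signPeak x
    · simp [J, h]
    · have : ∀ u ∈ U, I u x = 0 := fun u hu =>
        if_neg fun h' => h (h'.trans ((le_abs_self _).trans (abs_signCorr_le_signPeak (hU hu) x)))
      rw [Finset.sum_eq_zero this, zero_mul]
  -- Cauchy–Schwarz for the count X and the indicator J of a large peak: J = 1 wherever X ≠ 0, so (E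
  -- X)² ≤ E[X²] P(J = 1).
  have hcs := cubeMean_mul_sq_le (fun x => ∑ u ∈ U, I u x) J
  simp only [hXJ] at hcs
  have hJ2 : (fun x => J x ^ 2) = J := by
    ext x; simp [J]
  rw [hJ2, hJ] at hcs
  set π := cubeProb (fun x : Fin n → ℤˣ => b ≤ signPeak x)
  have hπ0 : 0 ≤ π := cubeProb_nonneg _
  have hkey : μ ^ 2 ≤ (μ + N ^ 2 * q) * π := hcs.trans (mul_le_mul_of_nonneg_right hsecond hπ0)
  -- The two entries of the minimum correspond to which term of μ + N²q dominates.
  rcases le_total (N ^ 2 * q) μ with h | h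
  · refine (min_le_left _ _).trans ?_
    have : μ * μ ≤ μ * (2 * π) := by nlinarith
    have := le_of_mul_le_mul_left this hμ0
    linarith
  · refine (min_le_right _ _).trans ?_
    rw [div_le_iff₀ (by positivity)]
    have h1 : (N * p) ^ 2 ≤ μ ^ 2 := by gcongr
    have h2 : N ^ 2 * p ^ 2 ≤ N ^ 2 * (π * (2 * q)) := by nlinarith
    exact le_of_mul_le_mul_left h2 (by positivity)

theorem cubeProb_signCorr_and_le {n u v : ℕ} (hu : 0 < u) (hv : 0 < v) (huv : u ≠ v) {t b : ℝ}
    (ht : 0 ≤ t) (ht4 : 4 * t ≤ 1) :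
    cubeProb (fun x : Fin n → ℤˣ => b ≤ signCorr u x ∧ b ≤ signCorr v x) ≤
      Real.exp (n * t ^ 2 + 64 * (n * t ^ 3) - 2 * t * b) := by
  have h := cubeProb_le_exp (fun x : Fin n → ℤˣ => t * (signCorr u x + signCorr v x))
    (2 * t * b) (cubeMean_exp_signCorr_add_le hu hv huv ht ht4)
  refine (cubeProb_mono fun x hx => ?_).trans h
  nlinarith [mul_le_mul_of_nonneg_left (add_le_add hx.1 hx.2) ht]

/-! ### Transfer to the uniform law on binary sequences -/

theorem signSeq_injective (n : ℕ) : Function.Injective (signSeq (n := n)) := by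
  intro x y h
  ext i
  exact congrFun h i

theorem binarySequences_eq_image (n : ℕ) :
    binarySequences n = ((Finset.univ.image (signSeq (n := n)) : Finset (Fin n → ℤ)) : Set _) := by
  ext a
  simp only [binarySequences, Set.mem_ofPred_eq, Finset.coe_image, Finset.coe_univ, Set.image_univ,
    Set.mem_range]
  constructor
  · intro h
    refine ⟨fun i => if a i = 1 then 1 else -1, ?_⟩
    ext i
    rcases h i with hi | hi <;> simp [signSeq, hi]
  · rintro ⟨x, rfl⟩ i
    rcases Int.units_eq_one_or (x i) with hi | hi <;> simp [signSeq, hi]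

theorem integral_uniformOn_binarySequences {n : ℕ} (f : (Fin n → ℤ) → ℝ) :
    ∫ a, f a ∂(uniformOn (binarySequences n)) = cubeMean (fun x => f (signSeq x)) := by
  have hint : ∀ s : Finset (Fin n → ℤ), IntegrableOn f s Measure.count := by
    intro s
    rw [← Set.biUnion_of_singleton (s : Set (Fin n → ℤ))]
    simp only [Finset.mem_coe]
    refine integrableOn_finset_iUnion.mpr fun a _ => integrableOn_singleton (by simp) (by simp)
  rw [uniformOn, ProbabilityTheory.cond, binarySequences_eq_image, integral_smul_measure,
    setIntegral_finset _ (hint _),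
    Finset.sum_image fun x _ y _ h => signSeq_injective n h, Measure.count_apply_finset,
    Finset.card_image_of_injective _ (signSeq_injective n)]
  simp [cubeMean, Fintype.card_pi, div_eq_inv_mul]

theorem measure_eq_cubeProb {n : ℕ} {Ω : Type*} [MeasurableSpace Ω] {P : Measure Ω}
    [IsProbabilityMeasure P] {A : Ω → Fin n → ℤ}
    (hA : HasLaw A (uniformOn (binarySequences n)) P) (q : (Fin n → ℤ) → Prop) :
    P {ω | q (A ω)} = ENNReal.ofReal (cubeProb fun x => q (signSeq x)) := by
  classical
  have hm : MeasurableSet {a | q a} := .of_discrete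
  have := hA.isProbabilityMeasure_iff.mp inferInstance
  rw [hA.measure_eq hm, ← ofReal_measureReal, ← integral_indicator_one hm,
    integral_uniformOn_binarySequences, cubeProb]
  congr 2

theorem integral_eq_cubeMean {n : ℕ} {Ω : Type*} [MeasurableSpace Ω] {P : Measure Ω}
    {A : Ω → Fin n → ℤ}
    (hA : HasLaw A (uniformOn (binarySequences n)) P) (f : (Fin n → ℤ) → ℝ) :
    ∫ ω, f (A ω) ∂P = cubeMean (fun x => f (signSeq x)) := by
  rw [← integral_uniformOn_binarySequences]
  exact hA.integral_comp (Measurable.of_discrete).aestronglyMeasurable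

/-! ### Lower bound with polynomially small probability -/

theorem tendsto_log_natCast : Tendsto (fun n : ℕ => Real.log n) atTop atTop :=
  Real.tendsto_log_atTop.comp tendsto_natCast_atTop_atTop

theorem eventually_log_pow_three_le {η : ℝ} (hη : 0 < η) :
    ∀ᶠ n : ℕ in atTop, Real.log n ^ 3 ≤ η * n := by
  have h := (Real.isLittleO_pow_log_id_atTop (n := 3)).comp_tendsto tendsto_natCast_atTop_atTop
  filter_upwards [h.bound hη, eventually_ge_atTop 1] with n hn h1
  have h0 : 0 ≤ Real.log n := Real.log_natCast_nonneg n
  simpa [abs_of_nonneg h0] using hn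

/-- First entry of the minimum: 2(1 - δ)²(1/2 + δ + δ²/4) ≤ 1 makes the single tail at least a
constant over m. With order δ²m shifts, the expected count is bounded below by a constant multiple
of δ². -/
theorem exp_neg_le_card_mul {δ m y N : ℝ} (hδ0 : 0 < δ) (hδ1 : δ < 1) (hm : 0 < m)
    (hl : 1 ≤ Real.log m) (hlN : -Real.log (δ ^ 2 / 48) / (10 * δ) ≤ Real.log m)
    (hy : y = 2 * (1 - δ) ^ 2 * Real.log m) (hN : δ ^ 2 / 4 * m ≤ N) :
    Real.exp (-(10 * δ * Real.log m)) ≤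
      N * (Real.exp (-y * (1 / 2 + δ + δ ^ 2 / 4) - 1) / 2) / 2 := by
  have hyℓ : y * (1 / 2 + δ + δ ^ 2 / 4) ≤ Real.log m := by
    have h1 : 2 * (1 - δ) ^ 2 * (1 / 2 + δ + δ ^ 2 / 4) ≤ 1 := by
      have h2 : 0 ≤ δ ^ 2 * (5 / 2 - δ - δ ^ 2 / 2) :=
        mul_nonneg (sq_nonneg δ) (by nlinarith)
      linarith
    rw [hy]
    nlinarith
  have h2 : Real.exp (-1) / m ≤ Real.exp (-y * (1 / 2 + δ + δ ^ 2 / 4) - 1) := by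
    rw [div_le_iff₀ hm]
    nth_rewrite 1 [← Real.exp_log hm]
    rw [← Real.exp_add, Real.exp_le_exp]
    linarith
  have h3 : (1 : ℝ) / 3 ≤ Real.exp (-1) := by
    rw [Real.exp_neg, one_div]
    exact inv_anti₀ (Real.exp_pos 1) (by linarith [Real.exp_one_lt_d9])
  have h4 : Real.exp (-(10 * δ * Real.log m)) ≤ δ ^ 2 / 48 := by
    rw [← Real.le_log_iff_exp_le (by positivity)]
    rw [div_le_iff₀ (by positivity)] at hlN
    linarith
  calc Real.exp (-(10 * δ * Real.log m)) ≤ δ ^ 2 / 48 := h4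
    _ = (δ ^ 2 / 4 * m) * ((1 / 3) / m / 2) / 2 := by field_simp; norm_num
    _ ≤ _ := by
        have hN0 : 0 ≤ N := le_trans (by positivity) hN
        gcongr
        exact (div_le_div_of_nonneg_right h3 hm.le).trans h2

/-- Second entry of the minimum: the exponents differ by y(4δ + δ²/2) ≤ 9δℓ, and the remaining δℓ ≥
6 absorbs the constants. -/
theorem exp_neg_le_sq_div {δ ℓ y : ℝ} (hδ0 : 0 < δ) (hδ1 : δ < 1) (hl : 1 ≤ ℓ) (hl6 : 6 / δ ≤ ℓ)
    (hy : y = 2 * (1 - δ) ^ 2 * ℓ) :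
    Real.exp (-(10 * δ * ℓ)) ≤ (Real.exp (-y * (1 / 2 + δ + δ ^ 2 / 4) - 1) / 2) ^ 2 /
      (2 * Real.exp (-y * (1 - 2 * δ) + 1)) := by
  rw [le_div_iff₀ (by positivity), div_pow, ← Real.exp_nat_mul, mul_left_comm, ← Real.exp_add]
  have h8 : (8 : ℝ) ≤ Real.exp 3 := by
    have := Real.quadratic_le_exp_of_nonneg (x := 3) (by norm_num)
    linarith
  have h5 : Real.exp (-(10 * δ * ℓ) + (-y * (1 - 2 * δ) + 1)) * 8 ≤
      Real.exp ((2 : ℕ) * (-y * (1 / 2 + δ + δ ^ 2 / 4) - 1)) := by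
    refine (mul_le_mul_of_nonneg_left h8 (Real.exp_nonneg _)).trans ?_
    rw [← Real.exp_add, Real.exp_le_exp]
    rw [div_le_iff₀ hδ0] at hl6
    have hy2 : y ≤ 2 * ℓ := by
      rw [hy]
      have : (1 - δ) ^ 2 ≤ 1 := by nlinarith
      nlinarith
    have : y * (4 * δ + δ ^ 2 / 2) ≤ 2 * ℓ * (4 * δ + δ / 2) := by
      gcongr
      nlinarith
    push_cast
    linarith
  linarith

/-- With probability at least an arbitrarily small power of `1 / n`, the peak sidelobe level is
close to `√(2 n log n)` or larger. -/
theorem eventually_le_cubeProb_signPeak {δ : ℝ} (hδ0 : 0 < δ) (hδ1 : δ < 1) :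
    ∀ᶠ n : ℕ in atTop, Real.exp (-(10 * δ * Real.log n)) ≤
      cubeProb (fun x : Fin n → ℤˣ =>
        (1 - δ) ^ 2 * (√2 * √((n : ℝ) * Real.log n)) ≤ signPeak x) := by
  have hlogδ := tendsto_log_natCast.eventually_ge_atTop
  -- The constant 32768 = 2·128² gives ℓr ≤ 1/128 below, which keeps the cubic error 64nt³ of the
  -- pair bound at most 1.
  filter_upwards [eventually_ge_atTop 2, eventually_log_pow_three_le (η := 1 / 32768) (by norm_num),
    hlogδ 1, hlogδ (12 / (2 * (1 - δ) ^ 2 * δ ^ 2)), hlogδ (6 / δ),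
    hlogδ (-Real.log (δ ^ 2 / 48) / (10 * δ)),
    tendsto_natCast_atTop_atTop.eventually_ge_atTop (4 / δ ^ 2)] with n hn hlog3 hl1 hly hl6 hlN hnδ
  set ℓ := Real.log n with hℓ
  have hn0 : (0 : ℝ) < n := by positivity
  have h1δ : 0 < 1 - δ := by linarith
  set r := √(2 * ℓ / n) with hr
  have hr0 : 0 ≤ r := Real.sqrt_nonneg _
  have hr2 : n * r ^ 2 = 2 * ℓ := by
    rw [hr, Real.sq_sqrt (by positivity)]; field_simp
  have hℓr : ℓ * r ≤ 1 / 128 := by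
    refine abs_le_of_sq_le_sq' ?_ (by norm_num) |>.2
    have : (ℓ * r) ^ 2 * n ≤ (1 / 128) ^ 2 * n := by
      calc (ℓ * r) ^ 2 * n = ℓ ^ 2 * (n * r ^ 2) := by ring
        _ = 2 * ℓ ^ 3 := by rw [hr2]; ring
        _ ≤ (1 / 128) ^ 2 * n := by linarith
    exact le_of_mul_le_mul_right this hn0
  have hr1 : r ≤ 1 / 128 := by nlinarith
  -- Here nr = √(2n log n). One factor 1 - δ makes the single tail no smaller than order 1/n; the
  -- other, in the threshold (1 - δ)nt, is the loss from tilting.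
  set t := (1 - δ) * r with ht
  have ht0 : 0 ≤ t := by positivity
  have htr : t ≤ r := by rw [ht]; nlinarith
  have hy : n * t ^ 2 = 2 * (1 - δ) ^ 2 * ℓ := by
    rw [ht, mul_pow]; linear_combination (1 - δ) ^ 2 * hr2
  have ht3 : 64 * (n * t ^ 3) ≤ 1 := by
    have : n * t ^ 3 ≤ n * r ^ 3 := by gcongr
    nlinarith
  have ht4 : n * t ^ 4 ≤ 4 := by
    have h3 : 0 ≤ n * t ^ 3 := by positivity
    have : n * t ^ 4 = (n * t ^ 3) * t := by ring
    nlinarith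
  have hb : (1 - δ) ^ 2 * (√2 * √(n * ℓ)) = (1 - δ) * (n * t) := by
    have : √2 * √(n * ℓ) = n * r := by
      rw [← Real.sqrt_mul (by norm_num), hr]
      nth_rewrite 2 [← Real.sqrt_sq hn0.le]
      rw [← Real.sqrt_mul (by positivity)]
      congr 1
      field_simp
    rw [this, ht]; ring
  rw [hb]
  have hy12 : 12 ≤ n * t ^ 2 * δ ^ 2 := by
    rw [div_le_iff₀ (by positivity)] at hly
    rw [hy]; linarith
  set y := n * t ^ 2 with hy_def
  -- Short shifts only, so that n - u is at least (1 - δ²/2)n, yet still a positive proportion of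
  -- all shifts.
  let U := Finset.Ioc 0 ⌊δ ^ 2 / 2 * n⌋₊
  have hUle : ∀ u ∈ U, (u : ℝ) ≤ δ ^ 2 / 2 * n := by
    intro u hu
    exact (Nat.cast_le.mpr (Finset.mem_Ioc.mp hu).2).trans (Nat.floor_le (by positivity))
  have hUpos : ∀ u ∈ U, 0 < u := fun u hu => (Finset.mem_Ioc.mp hu).1
  have hUlt : ∀ u ∈ U, u < n := by
    intro u hu
    have h2 : δ ^ 2 / 2 < 1 := by nlinarith
    have : (u : ℝ) < n := (hUle u hu).trans_lt (mul_lt_of_lt_one_left hn0 h2)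
    exact_mod_cast this
  have hcard : δ ^ 2 / 4 * n ≤ U.card := by
    rw [Nat.card_Ioc, Nat.sub_zero]
    have h1 := Nat.lt_floor_add_one (δ ^ 2 / 2 * (n : ℝ))
    rw [div_le_iff₀ (by positivity)] at hnδ
    linarith
  have hUne : U.Nonempty := by
    rw [← Finset.card_pos]
    have : (0 : ℝ) < U.card := lt_of_lt_of_le (by positivity) hcard
    exact_mod_cast this
  have hmin := min_le_cubeProb_signPeak (n := n) (U := U) (b := (1 - δ) * (n * t))
    (p := Real.exp (-y * (1 / 2 + δ + δ ^ 2 / 4) - 1) / 2)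
    (q := Real.exp (-y * (1 - 2 * δ) + 1))
    (fun u hu => Finset.mem_Ioo.mpr ⟨hUpos u hu, hUlt u hu⟩) hUne (by positivity) (by positivity)
    (fun u hu => le_cubeProb_signCorr (hUpos u hu) (hUlt u hu).le ht0 hδ0.le (hUle u hu) ht4 hy12)
    (fun u hu v hv huv => by
      refine (cubeProb_signCorr_and_le (hUpos u hu) (hUpos v hv) huv ht0 (by linarith)).trans ?_
      rw [Real.exp_le_exp, ← hy_def]
      have : 2 * t * ((1 - δ) * (n * t)) = 2 * (1 - δ) * y := by rw [hy_def]; ring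
      rw [this]
      linarith)
  exact (le_min (exp_neg_le_card_mul hδ0 hδ1 hn0 hl1 hlN hy hcard)
    (exp_neg_le_sq_div hδ0 hδ1 hl1 hl6 hy)).trans hmin

/-! ### Limits of the mean and of the peak -/

theorem log_mul_sq_eq_div {n : ℕ} (hn : 2 ≤ n) (ε : ℝ) :
    (ε * √((n : ℝ) * Real.log n)) ^ 2 / (8 * n) = ε ^ 2 / 8 * Real.log n := by
  have hn0 : (0 : ℝ) < n := by positivity
  rw [mul_pow, Real.sq_sqrt (mul_nonneg hn0.le (Real.log_natCast_nonneg n))]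
  field_simp

theorem sqrt_mul_log_pos {n : ℕ} (hn : 2 ≤ n) : 0 < √((n : ℝ) * Real.log n) :=
  Real.sqrt_pos.mpr (mul_pos (by positivity) (Real.log_pos (by exact_mod_cast hn)))

theorem tendsto_cubeMean_signPeak :
    Tendsto (fun n : ℕ => cubeMean (n := n) signPeak / √((n : ℝ) * Real.log n))
      atTop (𝓝 √2) := by
  refine tendsto_order.mpr ⟨fun a ha => ?_, fun a ha => ?_⟩
  · obtain ⟨ε, hε0, hε1, hεa⟩ : ∃ ε : ℝ, 0 < ε ∧ ε ≤ 1 ∧ a < √2 - 2 * ε := by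
      refine ⟨min 1 ((√2 - a) / 4), lt_min one_pos (by linarith), min_le_left _ _, ?_⟩
      have := min_le_right 1 ((√2 - a) / 4)
      linarith
    -- With δ = ε²/160, the lower bound n^(-10δ) = n^(-ε²/16) exceeds the concentration bound
    -- n^(-ε²/8).
    filter_upwards [eventually_ge_atTop 2,
      eventually_le_cubeProb_signPeak (δ := ε ^ 2 / 160) (by positivity) (by nlinarith)] with n hn h
    have hL := sqrt_mul_log_pos hn
    have hlog : 0 < Real.log n := Real.log_pos (by exact_mod_cast hn)
    rw [lt_div_iff₀ hL]
    by_contra! hcon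
    set L := √((n : ℝ) * Real.log n) with hL_def
    -- If the mean were at most aL < (√2 - 2ε)L, reaching (1 - δ)²√2 L ≥ (√2 - ε)L would be an
    -- upward deviation of at least εL.
    have hsub : cubeProb (fun x : Fin n → ℤˣ =>
        (1 - ε ^ 2 / 160) ^ 2 * (√2 * L) ≤ signPeak x) ≤
        cubeProb (fun x : Fin n → ℤˣ => cubeMean (n := n) signPeak + ε * L ≤ signPeak x) := by
      refine cubeProb_mono fun x hx => le_trans ?_ hx
      have h1 : √2 - ε ≤ (1 - ε ^ 2 / 160) ^ 2 * √2 := by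
        have h2 : √2 ≤ 2 := Real.sqrt_le_iff.mpr (by norm_num)
        have h3 : 0 ≤ √2 := Real.sqrt_nonneg _
        have h4 : 1 - ε / 2 ≤ (1 - ε ^ 2 / 160) ^ 2 := by nlinarith [sq_nonneg (ε ^ 2)]
        nlinarith
      have := mul_le_mul_of_nonneg_right h1 hL.le
      nlinarith
    have h1 := h.trans (hsub.trans (cubeProb_signPeak_upper hn (mul_pos hε0 hL)))
    rw [Real.exp_le_exp, hL_def, log_mul_sq_eq_div hn] at h1
    nlinarith [mul_pos (pow_pos hε0 2) hlog]
  · have hlim : Tendsto (fun n : ℕ => √2 + Real.log 2 / (√2 * Real.log n)) atTop (𝓝 (√2 + 0)) := by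
      refine tendsto_const_nhds.add (Tendsto.div_atTop tendsto_const_nhds ?_)
      exact tendsto_log_natCast.const_mul_atTop (by positivity)
    rw [add_zero] at hlim
    filter_upwards [eventually_ge_atTop 2, hlim.eventually_lt_const ha] with n hn h
    refine lt_of_le_of_lt ?_ h
    have hL := sqrt_mul_log_pos hn
    have hlog : 0 < Real.log n := Real.log_pos (by exact_mod_cast hn)
    have hn0 : (0 : ℝ) < n := by positivity
    set L := √((n : ℝ) * Real.log n) with hL_def
    have hL2 : L ^ 2 = n * Real.log n := Real.sq_sqrt (by positivity)
    have hs2 : √2 ^ 2 = 2 := Real.sq_sqrt (by norm_num)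
    have hs0 : 0 < √2 := by positivity
    -- This is t = √(2 log n / n), optimal up to the log 2 in log(2n), which leaves the error log
    -- 2/(√2 log n).
    have hM := cubeMean_signPeak_le hn (t := √2 * Real.log n / L) (by positivity)
    rw [div_le_iff₀ hL]
    refine hM.trans (le_of_eq ?_)
    rw [Real.log_mul (by norm_num) hn0.ne']
    have h1 : n * (√2 * Real.log n / L) / 2 = √2 / 2 * L := by
      field_simp
      linear_combination -hL2
    rw [h1]
    field_simp
    linear_combination -Real.log n * hs2

theorem tendsto_exp_neg_mul_log {c : ℝ} (hc : 0 < c) :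
    Tendsto (fun n : ℕ => Real.exp (-(c * Real.log n))) atTop (𝓝 0) :=
  Real.tendsto_exp_neg_atTop_nhds_zero.comp (tendsto_log_natCast.const_mul_atTop hc)

theorem tendsto_cubeProb_signPeak {ε : ℝ} (hε : 0 < ε) :
    Tendsto (fun n : ℕ => cubeProb (fun x : Fin n → ℤˣ =>
      ε ≤ |signPeak x / √((n : ℝ) * Real.log n) - √2|)) atTop (𝓝 0) := by
  have hlim : Tendsto (fun n : ℕ => 2 * Real.exp (-((ε / 2) ^ 2 / 8 * Real.log n)))
      atTop (𝓝 (2 * 0)) := (tendsto_exp_neg_mul_log (by positivity)).const_mul 2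
  rw [mul_zero] at hlim
  refine tendsto_of_tendsto_of_tendsto_of_le_of_le' tendsto_const_nhds hlim
    (Eventually.of_forall fun n => cubeProb_nonneg _) ?_
  -- Half of ε covers the distance of the normalised mean from √2, the other half the fluctuation
  -- about the mean.
  filter_upwards [eventually_ge_atTop 2,
    Metric.tendsto_nhds.mp tendsto_cubeMean_signPeak (ε / 2) (by positivity)] with n hn hE
  have hL := sqrt_mul_log_pos hn
  rw [Real.dist_eq, abs_lt] at hE
  have hup := cubeProb_signPeak_upper hn (mul_pos (half_pos hε) hL)
  have hlo := cubeProb_signPeak_lower hn (mul_pos (half_pos hε) hL)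
  rw [log_mul_sq_eq_div hn] at hup hlo
  set L := √((n : ℝ) * Real.log n)
  set m := cubeMean (n := n) signPeak
  have hm : m = m / L * L := by field_simp
  refine (cubeProb_mono fun x hx => ?_).trans ((cubeProb_or_le _ _).trans
    ((add_le_add hup hlo).trans (by linarith)))
  have hx' : signPeak x = signPeak x / L * L := by field_simp
  rw [hx', hm, ← add_mul, ← sub_mul]
  rcases le_abs.mp hx with h | h
  · exact Or.inl (mul_le_mul_of_nonneg_right (by linarith) hL.le)
  · exact Or.inr (mul_le_mul_of_nonneg_right (by linarith) hL.le)

theorem theorem1 {Ω : ℕ → Type*} [∀ n, MeasurableSpace (Ω n)]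
    (P : ∀ n, Measure (Ω n)) [∀ n, IsProbabilityMeasure (P n)]
    (A : ∀ n, Ω n → (Fin n → ℤ))
    (hA : ∀ n, HasLaw (A n) (uniformOn (binarySequences n)) (P n)) :
    (∀ ε : ℝ, 0 < ε →
      Tendsto
        (fun n : ℕ => P n {ω |
          ε ≤ |(peakSidelobeLevel (A n ω) : ℝ) / √((n : ℝ) * Real.log n) - √2|})
        atTop (𝓝 0)) ∧
    Tendsto
      (fun n : ℕ => (∫ ω, (peakSidelobeLevel (A n ω) : ℝ) ∂(P n)) / √((n : ℝ) * Real.log n))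
      atTop (𝓝 √2) := by
  constructor
  · intro ε hε
    have h := ENNReal.tendsto_ofReal (tendsto_cubeProb_signPeak hε)
    rw [ENNReal.ofReal_zero] at h
    refine h.congr fun n => ?_
    exact (measure_eq_cubeProb (hA n) fun a =>
      ε ≤ |(peakSidelobeLevel a : ℝ) / √((n : ℝ) * Real.log n) - √2|).symm
  · refine tendsto_cubeMean_signPeak.congr fun n => ?_
    rw [integral_eq_cubeMean (hA n) fun a => (peakSidelobeLevel a : ℝ)]
    rfl
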